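/- Modular equation of level two. For $\tau$ in the complex upper half plane $\mathbb{H}$ put $q=e^{2\pi i\tau}$, $q^{1/4}=e^{2\pi i\tau/4}$, let $$X(\tau)=q^{1/4}\prod_{n=1}^{\infty}\frac{(1-q^{6n-1})(1-q^{6n-5})}{(1-q^{6n-2})(1-q^{6n-4})}$$ be the (product form of the) continued fraction of order six, and let $w(\tau)=X(\tau)X(3\tau)$. Then for every $\tau\in\mathbb{H}$ $$w(\tau)^2-w(2\tau)+2w(\tau)w(2\tau)-3w(\tau)^2w(2\tau)+w(2\tau)^2=0,$$ and the polynomial $F_2(X,Y)=X^2-Y+2XY-3X^2Y+Y^2$ is irreducible in $\mathbb{C}[X,Y]$; that is, $F_2(w(\tau),w(2\tau))=0$ is the modular equation of level two for $w$. -/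

import Mathlib

/-- The continued fraction `X(τ)` of order six, through its infinite product
`q ^ (1/4) * ∏_{n ≥ 1} (1 - q^(6n-1)) (1 - q^(6n-5)) / ((1 - q^(6n-2)) (1 - q^(6n-4)))`,
where `q = exp (2 π i τ)` and `q ^ (1/4) = exp (2 π i τ / 4)`. The index is shifted so that it runs
over `n ≥ 0`. For `τ` in the upper half plane `‖q‖ < 1`, so no denominator vanishes and the product
converges absolutely. -/
noncomputable def contFracX (τ : ℂ) : ℂ :=
  Function.Periodic.qParam 4 τ *
    ∏' n : ℕ,
      ((1 - Function.Periodic.qParam 1 τ ^ (6 * n + 5)) *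
          (1 - Function.Periodic.qParam 1 τ ^ (6 * n + 1))) /
        ((1 - Function.Periodic.qParam 1 τ ^ (6 * n + 4)) *
          (1 - Function.Periodic.qParam 1 τ ^ (6 * n + 2)))

/-- The function `w(τ) = X(τ) X(3τ)`. -/
noncomputable def modularW (τ : ℂ) : ℂ :=
  contFracX τ * contFracX (3 * τ)

/-! Put `r = exp (π i τ)`, so `q = r ^ 2`, and let `θ(a, b) = ∑ r ^ (a n² + b n)` over the integers.
The products for `X(τ)` and `X(3τ)` telescope, and the Jacobi triple product gives `w(τ) = r² θ(9,9)
/ θ(1,1)`; replacing `r` by `r²` gives `w(2τ)`. The equation then follows by algebra from product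
identities (`thetaSeries_self_sq`, `thetaSeries_mul_eq`) and from 3-dissections of `θ(1,1)`,
`θ(2,2)` and `θ(2,0)`. For irreducibility, `F₂` is a monic quadratic in `Y` over `ℂ[X]` whose
discriminant has a simple zero at `X = 1`, so it is not a square. -/

open Filter Topology

/-! ### Infinite products over arithmetic progressions -/

/-- The product `∏ (1 + c * q ^ (m * n + a))` over `n ≥ 0`. -/
noncomputable def qProd (c q : ℂ) (m a : ℕ) : ℂ := ∏' n : ℕ, (1 + c * q ^ (m * n + a))

theorem summable_norm_mul_pow_arith (c : ℂ) {q : ℂ} (hq : ‖q‖ < 1) {m : ℕ} (hm : m ≠ 0) (a : ℕ) :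
    Summable fun n : ℕ => ‖c * q ^ (m * n + a)‖ := by
  have h : ‖q ^ m‖ < 1 := by
    rw [norm_pow]; exact pow_lt_one₀ (norm_nonneg _) hq hm
  have := (summable_geometric_of_lt_one (norm_nonneg _) h).mul_left (‖c‖ * ‖q‖ ^ a)
  refine this.congr fun n => ?_
  simp only [norm_mul, norm_pow, pow_add, pow_mul]; ring

theorem multipliable_qProd (c : ℂ) {q : ℂ} (hq : ‖q‖ < 1) {m : ℕ} (hm : m ≠ 0) (a : ℕ) :
    Multipliable fun n : ℕ => 1 + c * q ^ (m * n + a) :=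
  multipliable_one_add_of_summable (summable_norm_mul_pow_arith c hq hm a)

theorem qProd_pow (c q : ℂ) (k m a : ℕ) : qProd c (q ^ k) m a = qProd c q (k * m) (k * a) := by
  unfold qProd
  congr 1; ext n; rw [← pow_mul]; congr 3; ring

theorem qProd_neg_one_ne_zero {q : ℂ} (hq : ‖q‖ < 1) {m a : ℕ} (hm : m ≠ 0) (ha : a ≠ 0) :
    qProd (-1) q m a ≠ 0 := by
  refine tprod_one_add_ne_zero_of_summable (f := fun n => -1 * q ^ (m * n + a)) (fun n h => ?_)
    (summable_norm_mul_pow_arith _ hq hm a)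
  have h1 : q ^ (m * n + a) = 1 := by linear_combination -h
  have h2 : ‖q ^ (m * n + a)‖ < 1 := by
    rw [norm_pow]; exact pow_lt_one₀ (norm_nonneg _) hq (by omega)
  rw [h1] at h2; simp at h2

theorem qProd_split_two (c : ℂ) {q : ℂ} (hq : ‖q‖ < 1) {m : ℕ} (hm : m ≠ 0) (a : ℕ) :
    qProd c q m a = qProd c q (2 * m) a * qProd c q (2 * m) (m + a) := by
  have h0 := multipliable_qProd c hq (m := 2 * m) (by omega) a
  have h1 := multipliable_qProd c hq (m := 2 * m) (by omega) (m + a)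
  have e0 : ∀ n, 2 * m * n + a = m * (2 * n) + a := fun n => by ring
  have e1 : ∀ n, 2 * m * n + (m + a) = m * (2 * n + 1) + a := fun n => by ring
  simp only [e0] at h0
  simp only [e1] at h1
  have h := tprod_even_mul_odd (f := fun n : ℕ => 1 + c * q ^ (m * n + a)) h0 h1
  simp only [qProd, e0, e1]
  exact h.symm

theorem qProd_split_three (c : ℂ) {q : ℂ} (hq : ‖q‖ < 1) {m : ℕ} (hm : m ≠ 0) (a : ℕ) :
    qProd c q m a =
      qProd c q (3 * m) a * qProd c q (3 * m) (m + a) * qProd c q (3 * m) (2 * m + a) := by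
  have t := (multipliable_qProd c hq hm a).tendsto_prod_tprod_nat.comp
    (tendsto_id.const_mul_atTop' (show 0 < 3 by norm_num))
  have t0 := (multipliable_qProd c hq (m := 3 * m) (by omega) a).tendsto_prod_tprod_nat
  have t1 := (multipliable_qProd c hq (m := 3 * m) (by omega) (m + a)).tendsto_prod_tprod_nat
  have t2 := (multipliable_qProd c hq (m := 3 * m) (by omega) (2 * m + a)).tendsto_prod_tprod_nat
  refine tendsto_nhds_unique t (((t0.mul t1).mul t2).congr fun N => ?_)
  induction N with
  | zero => simp
  | succ N ih =>
    have : 3 * (N + 1) = 3 * N + 1 + 1 + 1 := by ring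
    simp only [Function.comp, id, this, Finset.prod_range_succ] at ih ⊢
    rw [← ih]; ring

theorem qProd_one_mul_neg_one {q : ℂ} (hq : ‖q‖ < 1) {m : ℕ} (hm : m ≠ 0) (a : ℕ) :
    qProd 1 q m a * qProd (-1) q m a = qProd (-1) q (2 * m) (2 * a) := by
  unfold qProd
  rw [← (multipliable_qProd 1 hq hm a).tprod_mul (multipliable_qProd (-1) hq hm a)]
  congr 1; ext n
  rw [show 2 * m * n + 2 * a = (m * n + a) * 2 by ring, pow_mul]; ring

theorem qProd_one_zero {q : ℂ} (hq : ‖q‖ < 1) {m : ℕ} (hm : m ≠ 0) :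
    qProd 1 q m 0 = 2 * qProd 1 q m m := by
  have hs := multipliable_qProd 1 hq hm m
  have e : ∀ n, m * n + m = m * (n + 1) + 0 := fun n => by ring
  simp only [e] at hs
  have h := tprod_eq_zero_mul' (f := fun n : ℕ => 1 + 1 * q ^ (m * n + 0)) hs
  simp only [qProd, e]
  rw [h, mul_zero, zero_add, pow_zero]
  norm_num

/-! ### Jacobi triple product, as a limit of its finite form -/

/-- The reciprocal of `(1 - q) ⋯ (1 - q ^ m)`, extended by zero to negative `m`. -/
noncomputable def invQFactorial (q : ℂ) (m : ℤ) : ℂ :=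
  if m < 0 then 0 else (∏ k ∈ Finset.range m.toNat, (1 - q ^ (k + 1)))⁻¹

theorem one_sub_pow_ne_zero {q : ℂ} (hq : ‖q‖ < 1) (k : ℕ) : 1 - q ^ (k + 1) ≠ 0 := by
  intro h
  have h1 : q ^ (k + 1) = 1 := by linear_combination -h
  have h2 : ‖q ^ (k + 1)‖ < 1 := by
    rw [norm_pow]; exact pow_lt_one₀ (norm_nonneg _) hq (by omega)
  rw [h1] at h2; simp at h2

/-- The extension by zero is consistent at `m = -1` because `1 - q ^ 0 = 0`. The recurrence thus
holds on all of `ℤ`, with no support conditions. -/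
theorem invQFactorial_eq {q : ℂ} (hq : ‖q‖ < 1) (m : ℤ) :
    invQFactorial q m = (1 - q ^ (m + 1)) * invQFactorial q (m + 1) := by
  rcases lt_trichotomy m (-1) with h | h | h
  · simp [invQFactorial, show m < 0 by omega, show m + 1 < 0 by omega]
  · subst h; simp [invQFactorial]
  · obtain ⟨n, rfl⟩ := Int.eq_ofNat_of_zero_le (show 0 ≤ m by omega)
    have := one_sub_pow_ne_zero hq n
    have e : ((n : ℤ) + 1).toNat = n + 1 := by omega
    have e' : q ^ ((n : ℤ) + 1) = q ^ (n + 1) := by exact_mod_cast zpow_natCast q (n + 1)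
    rw [invQFactorial, invQFactorial, if_neg (by omega), if_neg (by omega), e, e',
      Finset.prod_range_succ, Int.toNat_natCast, mul_inv]
    field_simp

theorem tendsto_qFactorial {q : ℂ} (hq : ‖q‖ < 1) :
    Tendsto (fun N : ℕ => ∏ k ∈ Finset.range N, (1 - q ^ (k + 1))) atTop
      (𝓝 (qProd (-1) q 1 1)) := by
  have := (multipliable_qProd (-1) hq one_ne_zero 1).tendsto_prod_tprod_nat
  refine this.congr fun N => Finset.prod_congr rfl fun k _ => ?_
  rw [one_mul]; ring

theorem tendsto_invQFactorial {q : ℂ} (hq : ‖q‖ < 1) (f : ℕ → ℤ) (hf : Tendsto f atTop atTop) :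
    Tendsto (fun N : ℕ => invQFactorial q (f N)) atTop (𝓝 (qProd (-1) q 1 1)⁻¹) := by
  have h1 : Tendsto (fun N => (f N).toNat) atTop atTop := by
    refine tendsto_atTop.2 fun b => ?_
    filter_upwards [hf.eventually_ge_atTop (b : ℤ)] with N hN
    omega
  refine (((tendsto_qFactorial hq).inv₀
    (qProd_neg_one_ne_zero hq one_ne_zero one_ne_zero)).comp h1).congr' ?_
  filter_upwards [hf.eventually_ge_atTop 0] with N hN
  simp [invQFactorial, not_lt.2 hN]

theorem exists_norm_invQFactorial_le {q : ℂ} (hq : ‖q‖ < 1) :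
    ∃ C : ℝ, 0 ≤ C ∧ ∀ m : ℤ, ‖invQFactorial q m‖ ≤ C := by
  have ht := tendsto_invQFactorial hq (fun n => (n : ℤ)) tendsto_natCast_atTop_atTop
  obtain ⟨C, hC⟩ := (Metric.isBounded_range_of_tendsto _ ht).exists_norm_le
  have hC0 : 0 ≤ C := (norm_nonneg _).trans (hC _ ⟨0, rfl⟩)
  refine ⟨C, hC0, fun m => ?_⟩
  by_cases hm : m < 0
  · simpa [invQFactorial, hm] using hC0
  · obtain ⟨n, rfl⟩ := Int.eq_ofNat_of_zero_le (not_lt.1 hm)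
    exact hC _ ⟨n, rfl⟩

/-- The coefficient of `z ^ n` in `∏ (1 + z x ^ (2 k + 1)) (1 + z⁻¹ x ^ (2 k + 1))` over `k < N`. -/
noncomputable def tripleCoeff (x : ℂ) (N : ℕ) (n : ℤ) : ℂ :=
  (∏ k ∈ Finset.range (2 * N), (1 - (x ^ 2) ^ (k + 1))) *
    invQFactorial (x ^ 2) (N - n) * invQFactorial (x ^ 2) (N + n) * x ^ (n ^ 2)

theorem norm_sq_lt_one {x : ℂ} (hx : ‖x‖ < 1) : ‖x ^ 2‖ < 1 := by
  rw [norm_pow]; exact pow_lt_one₀ (norm_nonneg _) hx two_ne_zero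

/-- This is the effect on coefficients of multiplying by `(1 + z X) (1 + z⁻¹ X) = 1 + X² + z X + z⁻¹
X` with `X = x ^ (2 N + 1)`. -/
theorem tripleCoeff_succ {x : ℂ} (hx0 : x ≠ 0) (hx : ‖x‖ < 1) (N : ℕ) (n : ℤ) :
    tripleCoeff x (N + 1) n = (1 + (x ^ (2 * N + 1)) ^ 2) * tripleCoeff x N n +
      x ^ (2 * N + 1) * tripleCoeff x N (n - 1) + x ^ (2 * N + 1) * tripleCoeff x N (n + 1) := by
  have hq := norm_sq_lt_one hx
  have hp : ∀ m k : ℤ, k = m + 1 → invQFactorial (x ^ 2) m =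
      (1 - (x ^ 2) ^ k) * invQFactorial (x ^ 2) k := by
    rintro m _ rfl; exact invQFactorial_eq hq m
  have g1 := hp (N - n) (N + 1 - n) (by ring)
  have g2 := hp (N + n) (N + 1 + n) (by ring)
  have g3 := hp (N + (n - 1)) (N + n) (by ring)
  have g4 := hp (N - (n + 1)) (N - n) (by ring)
  have i1 : (N : ℤ) - (n - 1) = N + 1 - n := by ring
  have i2 : (N : ℤ) + (n + 1) = N + 1 + n := by ring
  have hy : x ^ n ≠ 0 := zpow_ne_zero _ hx0
  have p : ∀ k : ℤ, (x ^ 2) ^ k = (x ^ k) ^ 2 := fun k => by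
    rw [← zpow_natCast, ← zpow_natCast, zpow_comm]
  have s1 : x ^ ((n - 1) ^ 2) = x ^ (n ^ 2) * x / (x ^ n) ^ 2 := by
    rw [eq_div_iff (pow_ne_zero _ hy), ← zpow_natCast (x ^ n), ← zpow_mul, ← zpow_add₀ hx0,
      ← zpow_add_one₀ hx0]
    congr 1; push_cast; ring
  have s2 : x ^ ((n + 1) ^ 2) = x ^ (n ^ 2) * x * (x ^ n) ^ 2 := by
    rw [← zpow_natCast (x ^ n), ← zpow_mul, ← zpow_add_one₀ hx0, ← zpow_add₀ hx0]
    congr 1; push_cast; ring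
  have r1 : 2 * (N + 1) = 2 * N + 1 + 1 := by ring
  unfold tripleCoeff
  rw [i1, i2, g4, g3, g1, g2, s1, s2, r1, Finset.prod_range_succ, Finset.prod_range_succ]
  push_cast
  simp only [p]
  rw [show (N : ℤ) + 1 - n = (N : ℤ) - n + 1 by ring, show (N : ℤ) + 1 + n = (N : ℤ) + n + 1 by ring,
    zpow_add_one₀ hx0, zpow_add_one₀ hx0, zpow_sub₀ hx0, zpow_add₀ hx0, zpow_natCast]
  field_simp
  ring

theorem hasSum_tripleCoeff {x z : ℂ} (hx0 : x ≠ 0) (hx : ‖x‖ < 1) (hz : z ≠ 0) (N : ℕ) :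
    HasSum (fun n : ℤ => tripleCoeff x N n * z ^ n)
      (∏ k ∈ Finset.range N, ((1 + z * x ^ (2 * k + 1)) * (1 + z⁻¹ * x ^ (2 * k + 1)))) := by
  induction N with
  | zero =>
    have : (fun n : ℤ => tripleCoeff x 0 n * z ^ n) = fun n => if n = 0 then 1 else 0 := by
      ext n
      rcases lt_trichotomy n 0 with h | h | h
      · simp [tripleCoeff, invQFactorial, h, h.ne]
      · simp [tripleCoeff, invQFactorial, h]
      · simp [tripleCoeff, invQFactorial, h, h.ne']
    rw [this, Finset.prod_range_zero]
    exact hasSum_ite_eq 0 1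
  | succ N ih =>
    have a := (Equiv.subRight (1 : ℤ)).hasSum_iff.2 ih
    have b := (Equiv.addRight (1 : ℤ)).hasSum_iff.2 ih
    have s := ((ih.mul_left (1 + (x ^ (2 * N + 1)) ^ 2)).add (a.mul_left (z * x ^ (2 * N + 1)))).add
      (b.mul_left (z⁻¹ * x ^ (2 * N + 1)))
    rw [Finset.prod_range_succ]
    have e : ∀ P X : ℂ, P * ((1 + z * X) * (1 + z⁻¹ * X)) =
        (1 + X ^ 2) * P + z * X * P + z⁻¹ * X * P := fun P X => by field_simp; ring
    rw [e]
    refine (congrArg (HasSum · _) (funext fun n => ?_)).mpr s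
    simp only [Function.comp, Equiv.coe_addRight, Equiv.subRight_apply]
    rw [tripleCoeff_succ hx0 hx, zpow_sub_one₀ hz, zpow_add_one₀ hz]
    field_simp

theorem summable_zpow_sq_mul_zpow {x z : ℂ} (hx0 : x ≠ 0) (hx : ‖x‖ < 1) (hz : z ≠ 0) :
    Summable fun n : ℤ => x ^ (n ^ 2) * z ^ n := by
  have hpi : (Real.pi : ℂ) ≠ 0 := by exact_mod_cast Real.pi_ne_zero
  -- With `x = exp (π i σ)`, the condition `‖x‖ < 1` says `σ` has positive imaginary part, which is
  -- the convergence criterion for the theta function.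
  have him : 0 < (Complex.log x / (Real.pi * Complex.I)).im := by
    rw [show Complex.log x / (Real.pi * Complex.I) =
      ((-Real.pi⁻¹ : ℝ) : ℂ) * (Complex.log x * Complex.I) by
        push_cast; field_simp; rw [Complex.I_sq]; ring, Complex.im_ofReal_mul, Complex.mul_I_im,
      Complex.log_re]
    exact mul_pos_of_neg_of_neg (neg_lt_zero.2 (inv_pos.2 Real.pi_pos))
      (Real.log_neg (norm_pos_iff.2 hx0) hx)
  have h := (summable_jacobiTheta₂_term_iff (Complex.log z / (2 * Real.pi * Complex.I)) _).2 him
  refine h.congr fun n => ?_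
  rw [jacobiTheta₂_term, show 2 * Real.pi * Complex.I * n *
      (Complex.log z / (2 * Real.pi * Complex.I)) + Real.pi * Complex.I * n ^ 2 *
      (Complex.log x / (Real.pi * Complex.I)) =
      ((n ^ 2 : ℤ) : ℂ) * Complex.log x + n * Complex.log z by push_cast; field_simp; ring,
    Complex.exp_add, Complex.exp_int_mul, Complex.exp_int_mul, Complex.exp_log hx0,
    Complex.exp_log hz]

theorem jacobi_triple_product {x z : ℂ} (hx0 : x ≠ 0) (hx : ‖x‖ < 1) (hz : z ≠ 0) :
    ∑' n : ℤ, x ^ (n ^ 2) * z ^ n =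
      qProd z x 2 1 * qProd z⁻¹ x 2 1 * qProd (-1) x 2 2 := by
  have hq := norm_sq_lt_one hx
  have hE : qProd (-1) (x ^ 2) 1 1 = qProd (-1) x 2 2 := qProd_pow _ _ _ _ _
  have hE0 : qProd (-1) (x ^ 2) 1 1 ≠ 0 := qProd_neg_one_ne_zero hq one_ne_zero one_ne_zero
  have hsum := summable_zpow_sq_mul_zpow hx0 hx hz
  obtain ⟨C, hC0, hC⟩ := exists_norm_invQFactorial_le hq
  have hfac := (tendsto_qFactorial hq).comp
    (tendsto_id.const_mul_atTop' (show 0 < 2 by norm_num))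
  obtain ⟨C', hC'⟩ := (Metric.isBounded_range_of_tendsto _ hfac).exists_norm_le
  -- With `E = ∏ (1 - x ^ (2 k + 2))`, the three factors of `tripleCoeff` tend to `E`, `E⁻¹` and
  -- `E⁻¹`. Their uniform bounds justify the termwise limit.
  have hL : Tendsto (fun N : ℕ => ∑' n : ℤ, tripleCoeff x N n * z ^ n) atTop
      (𝓝 (∑' n : ℤ, (qProd (-1) x 2 2)⁻¹ * (x ^ (n ^ 2) * z ^ n))) := by
    refine tendsto_tsum_of_dominated_convergence
      (bound := fun n : ℤ => C' * C * C * ‖x ^ (n ^ 2) * z ^ n‖) (hsum.norm.mul_left _)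
      (fun n => ?_) (Eventually.of_forall fun N n => ?_)
    · have h1 := tendsto_invQFactorial hq (fun N : ℕ => (N : ℤ) - n)
        (tendsto_atTop_add_const_right _ (-n) tendsto_natCast_atTop_atTop)
      have h2 := tendsto_invQFactorial hq (fun N : ℕ => (N : ℤ) + n)
        (tendsto_atTop_add_const_right _ n tendsto_natCast_atTop_atTop)
      have h3 := ((hfac.mul h1).mul h2).mul_const (x ^ (n ^ 2) * z ^ n)
      rw [mul_inv_cancel₀ hE0, one_mul, hE] at h3
      refine h3.congr fun N => ?_
      simp only [tripleCoeff, Function.comp, id]; ring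
    · have h1 : ‖∏ k ∈ Finset.range (2 * N), (1 - (x ^ 2) ^ (k + 1))‖ ≤ C' := hC' _ ⟨N, rfl⟩
      have h2 := hC (N - n)
      have h3 := hC (N + n)
      have h0 : 0 ≤ C' := (norm_nonneg _).trans h1
      rw [tripleCoeff, mul_assoc, norm_mul, norm_mul, norm_mul]
      gcongr
  have hR1 := (multipliable_qProd z hx two_ne_zero 1).tendsto_prod_tprod_nat
  have hR2 := (multipliable_qProd z⁻¹ hx two_ne_zero 1).tendsto_prod_tprod_nat
  have hR := tendsto_nhds_unique hL ((hR1.mul hR2).congr fun N => by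
    rw [(hasSum_tripleCoeff hx0 hx hz N).tsum_eq, Finset.prod_mul_distrib])
  rw [tsum_mul_left, inv_mul_eq_iff_eq_mul₀ (hE ▸ hE0)] at hR
  rw [hR]; simp only [qProd]; ring

/-! ### Theta series: product forms, 3-dissections and product identities -/

/-- The theta series `∑ r ^ (a n² + b n)` over all integers `n`. -/
noncomputable def thetaSeries (r : ℂ) (a b : ℕ) : ℂ := ∑' n : ℤ, r ^ ((a : ℤ) * n ^ 2 + b * n)

theorem thetaSeries_pow (r : ℂ) (k a b : ℕ) :
    thetaSeries (r ^ k) a b = thetaSeries r (k * a) (k * b) := by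
  unfold thetaSeries
  congr 1; ext n
  rw [← zpow_natCast r k, ← zpow_mul]; congr 1; push_cast; ring

theorem zpow_quadratic {r : ℂ} (hr0 : r ≠ 0) (a b : ℕ) (n : ℤ) :
    r ^ ((a : ℤ) * n ^ 2 + b * n) = (r ^ a) ^ (n ^ 2) * (r ^ b) ^ n := by
  rw [zpow_add₀ hr0, zpow_mul, zpow_mul, zpow_natCast, zpow_natCast]

theorem summable_thetaSeries {r : ℂ} (hr0 : r ≠ 0) (hr : ‖r‖ < 1) {a : ℕ} (ha : a ≠ 0) (b : ℕ) :
    Summable fun n : ℤ => r ^ ((a : ℤ) * n ^ 2 + b * n) := by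
  simp only [zpow_quadratic hr0]
  exact summable_zpow_sq_mul_zpow (pow_ne_zero _ hr0)
    (by rw [norm_pow]; exact pow_lt_one₀ (norm_nonneg _) hr ha) (pow_ne_zero _ hr0)

theorem thetaSeries_eq_qProd {r : ℂ} (hr0 : r ≠ 0) (hr : ‖r‖ < 1) {a b : ℕ} (ha : a ≠ 0)
    (hab : b ≤ a) : thetaSeries r a b = qProd 1 r (2 * a) (a + b) * qProd 1 r (2 * a) (a - b) *
      qProd (-1) r (2 * a) (2 * a) := by
  have hb := pow_ne_zero b hr0
  have h := jacobi_triple_product (pow_ne_zero a hr0)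
    (by rw [norm_pow]; exact pow_lt_one₀ (norm_nonneg _) hr ha) hb
  have h1 : qProd (r ^ b) (r ^ a) 2 1 = qProd 1 r (2 * a) (a + b) := by
    refine tprod_congr fun n => ?_
    rw [← pow_mul, ← pow_add, one_mul]; congr 2; ring
  have h2 : qProd (r ^ b)⁻¹ (r ^ a) 2 1 = qProd 1 r (2 * a) (a - b) := by
    refine tprod_congr fun n => ?_
    obtain ⟨c, rfl⟩ := Nat.exists_eq_add_of_le hab
    rw [← pow_mul, one_mul, show (b + c) * (2 * n + 1) = b + (2 * (b + c) * n + (b + c - b)) by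
      rw [Nat.add_sub_cancel_left]; ring, pow_add r b, inv_mul_cancel_left₀ hb]
  rw [h1, h2, qProd_pow, mul_comm a 2] at h
  rw [← h]
  exact tsum_congr (zpow_quadratic hr0 a b)

theorem tsum_int_split_three {f : ℤ → ℂ} (hf : Summable f) :
    ∑' n, f n = ∑' n, f (3 * n) + ∑' n, f (3 * n + 1) + ∑' n, f (3 * n + 2) := by
  have hs : Summable (f ∘ (Int.divModEquiv 3).symm) := (Equiv.summable_iff _).2 hf
  have hs' : ∀ i : Fin 3, Summable fun n : ℤ => f (n * 3 + i) := fun i =>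
    hs.comp_injective (i := fun n : ℤ => (n, i)) fun _ _ h => (Prod.mk.inj h).1
  rw [← (Int.divModEquiv 3).symm.tsum_eq f]
  change ∑' p, (f ∘ (Int.divModEquiv 3).symm) p = _
  rw [hs.tsum_prod' fun n => Summable.of_finite]
  simp only [tsum_fintype, Fin.sum_univ_three]
  change ∑' n : ℤ, (f (n * 3 + (0 : Fin 3)) + f (n * 3 + (1 : Fin 3)) + f (n * 3 + (2 : Fin 3))) = _
  rw [((hs' 0).add (hs' 1)).tsum_add (hs' 2), (hs' 0).tsum_add (hs' 1)]
  simp [mul_comm]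

theorem tsum_int_reflect (f : ℤ → ℂ) : ∑' n, f n = ∑' n, f (-1 - n) :=
  ((Equiv.subLeft (-1 : ℤ)).tsum_eq f).symm

/-- Three-dissection of `∑ r ^ (k (n² + n))`. -/
theorem thetaSeries_self_dissection {r : ℂ} (hr0 : r ≠ 0) (hr : ‖r‖ < 1) {k : ℕ} (hk : k ≠ 0) :
    thetaSeries r k k =
      2 * thetaSeries r (9 * k) (3 * k) + r ^ (2 * k) * thetaSeries r (9 * k) (9 * k) := by
  have h0 : ∑' n : ℤ, r ^ ((k : ℤ) * (3 * n) ^ 2 + k * (3 * n)) =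
      thetaSeries r (9 * k) (3 * k) :=
    tsum_congr fun n => by congr 1; push_cast; ring
  have h1 : ∑' n : ℤ, r ^ ((k : ℤ) * (3 * n + 1) ^ 2 + k * (3 * n + 1)) =
      r ^ (2 * k) * thetaSeries r (9 * k) (9 * k) := by
    rw [thetaSeries, ← tsum_mul_left]
    refine tsum_congr fun n => ?_
    rw [← zpow_natCast, ← zpow_add₀ hr0]; congr 1; push_cast; ring
  have h2 : ∑' n : ℤ, r ^ ((k : ℤ) * (3 * n + 2) ^ 2 + k * (3 * n + 2)) =
      thetaSeries r (9 * k) (3 * k) := by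
    -- Under `n ↦ -1 - n`, `3 n + 2` becomes `-(3 n + 1)`, and `m² + m` at `-(3 n + 1)` equals its
    -- value at `3 n`.
    rw [tsum_int_reflect]
    exact tsum_congr fun n => by congr 1; push_cast; ring
  rw [thetaSeries, tsum_int_split_three (summable_thetaSeries hr0 hr hk k), h0, h1, h2]
  ring

/-- Three-dissection of `∑ r ^ (k n²)`. -/
theorem thetaSeries_zero_dissection {r : ℂ} (hr0 : r ≠ 0) (hr : ‖r‖ < 1) {k : ℕ} (hk : k ≠ 0) :
    thetaSeries r k 0 = thetaSeries r (9 * k) 0 + 2 * r ^ k * thetaSeries r (9 * k) (6 * k) := by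
  have h0 : ∑' n : ℤ, r ^ ((k : ℤ) * (3 * n) ^ 2 + (0 : ℕ) * (3 * n)) =
      thetaSeries r (9 * k) 0 :=
    tsum_congr fun n => by congr 1; push_cast; ring
  have h1 : ∑' n : ℤ, r ^ ((k : ℤ) * (3 * n + 1) ^ 2 + (0 : ℕ) * (3 * n + 1)) =
      r ^ k * thetaSeries r (9 * k) (6 * k) := by
    rw [thetaSeries, ← tsum_mul_left]
    refine tsum_congr fun n => ?_
    rw [← zpow_natCast, ← zpow_add₀ hr0]; congr 1; push_cast; ring
  have h2 : ∑' n : ℤ, r ^ ((k : ℤ) * (3 * n + 2) ^ 2 + (0 : ℕ) * (3 * n + 2)) =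
      r ^ k * thetaSeries r (9 * k) (6 * k) := by
    rw [tsum_int_reflect, thetaSeries, ← tsum_mul_left]
    refine tsum_congr fun n => ?_
    rw [← zpow_natCast, ← zpow_add₀ hr0]; congr 1; push_cast; ring
  rw [thetaSeries, tsum_int_split_three (summable_thetaSeries hr0 hr hk 0), h0, h1, h2]
  ring

theorem thetaSeries_self_eq {r : ℂ} (hr0 : r ≠ 0) (hr : ‖r‖ < 1) {k : ℕ} (hk : k ≠ 0) :
    thetaSeries r k k =
      2 * qProd 1 r (2 * k) (2 * k) ^ 2 * qProd (-1) r (2 * k) (2 * k) := by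
  rw [thetaSeries_eq_qProd hr0 hr hk le_rfl, Nat.sub_self, qProd_one_zero hr (by omega),
    ← two_mul]
  ring

theorem thetaSeries_self_mul_qProd {r : ℂ} (hr0 : r ≠ 0) (hr : ‖r‖ < 1) {k : ℕ} (hk : k ≠ 0) :
    thetaSeries r k k * qProd (-1) r (2 * k) (2 * k) =
      2 * qProd (-1) r (2 * (2 * k)) (2 * (2 * k)) ^ 2 := by
  rw [thetaSeries_self_eq hr0 hr hk,
    ← qProd_one_mul_neg_one hr (m := 2 * k) (by omega)]
  ring

theorem thetaSeries_self_ne_zero {r : ℂ} (hr0 : r ≠ 0) (hr : ‖r‖ < 1) {k : ℕ} (hk : k ≠ 0) :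
    thetaSeries r k k ≠ 0 := by
  refine left_ne_zero_of_mul (b := qProd (-1) r (2 * k) (2 * k)) ?_
  rw [thetaSeries_self_mul_qProd hr0 hr hk]
  exact mul_ne_zero two_ne_zero
    (pow_ne_zero _ (qProd_neg_one_ne_zero hr (by omega) (by omega)))

theorem thetaSeries_self_sq {r : ℂ} (hr0 : r ≠ 0) (hr : ‖r‖ < 1) {k : ℕ} (hk : k ≠ 0) :
    thetaSeries r k k ^ 2 = 2 * thetaSeries r (2 * k) 0 * thetaSeries r (2 * k) (2 * k) := by
  rw [thetaSeries_self_eq hr0 hr hk, thetaSeries_self_eq hr0 hr (k := 2 * k) (by omega),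
    thetaSeries_eq_qProd hr0 hr (a := 2 * k) (by omega) (Nat.zero_le _), add_zero, Nat.sub_zero,
    ← qProd_one_mul_neg_one hr (m := 2 * k) (by omega),
    qProd_split_two 1 hr (show 2 * k ≠ 0 by omega) (2 * k), ← two_mul]
  ring

/-- On both sides the exponents in the factors `1 + r ^ j` include the residues 6, 12, 24, 30 modulo
36: the left groups them modulo 18, the right pairs 6 with 30 and 12 with 24. -/
theorem thetaSeries_mul_eq {r : ℂ} (hr0 : r ≠ 0) (hr : ‖r‖ < 1) :
    thetaSeries r 9 3 * thetaSeries r 9 9 = 2 * thetaSeries r 18 12 * thetaSeries r 18 6 := by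
  rw [thetaSeries_self_eq hr0 hr (by omega), thetaSeries_eq_qProd hr0 hr (by omega) (by omega),
    thetaSeries_eq_qProd hr0 hr (by omega) (by omega),
    thetaSeries_eq_qProd hr0 hr (by omega) (by omega)]
  have h1 := qProd_split_two 1 hr (m := 18) (by omega) 12
  have h2 := qProd_split_two 1 hr (m := 18) (by omega) 6
  have h3 := qProd_one_mul_neg_one hr (m := 18) (by omega) 18
  norm_num at h1 h2 h3 ⊢
  rw [h1, h2, ← h3]
  ring

/-! ### `w` as a quotient of theta series -/

/-- The residues 2, 10 and 4, 8 modulo 12 are the classes 2 and 0 modulo 4 with 6 and 0 modulo 12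
removed. In this form `X(τ) X(3τ)` telescopes. -/
theorem contFracX_eq {τ r : ℂ} (hr : ‖r‖ < 1) (h : Function.Periodic.qParam 1 τ = r ^ 2) :
    contFracX τ * (qProd (-1) r 4 4 * qProd (-1) r 12 6) =
      Function.Periodic.qParam 4 τ * qProd (-1) r 4 2 * qProd (-1) r 12 12 := by
  have hX : contFracX τ = Function.Periodic.qParam 4 τ *
      (qProd (-1) r 12 10 * qProd (-1) r 12 2 / (qProd (-1) r 12 8 * qProd (-1) r 12 4)) := by
    have hp := fun a => (multipliable_qProd (-1) hr (m := 12) (by omega) a).hasProd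
    have h8 := qProd_neg_one_ne_zero hr (m := 12) (a := 8) (by omega) (by omega)
    have h4 := qProd_neg_one_ne_zero hr (m := 12) (a := 4) (by omega) (by omega)
    have := ((hp 10).mul (hp 2)).div₀ ((hp 8).mul (hp 4)) (mul_ne_zero h8 h4)
    rw [contFracX, qProd, qProd, qProd, qProd, ← this.tprod_eq, h]
    congr 1
    refine tprod_congr fun n => ?_
    simp only [← pow_mul]
    ring_nf
  have h1 := qProd_split_three (-1) hr (m := 4) (by omega) 4
  have h2 := qProd_split_three (-1) hr (m := 4) (by omega) 2
  have h8 := qProd_neg_one_ne_zero hr (m := 12) (a := 8) (by omega) (by omega)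
  have h4 := qProd_neg_one_ne_zero hr (m := 12) (a := 4) (by omega) (by omega)
  norm_num at h1 h2
  rw [hX, h1, h2]
  field_simp

theorem modularW_eq {τ r : ℂ} (hr0 : r ≠ 0) (hr : ‖r‖ < 1) (h : Function.Periodic.qParam 2 τ = r) :
    modularW τ = r ^ 2 * thetaSeries r 9 9 / thetaSeries r 1 1 := by
  have hq : ∀ k : ℕ, Function.Periodic.qParam 1 (k * τ) = (r ^ k) ^ 2 := fun k => by
    rw [← h, Function.Periodic.qParam, Function.Periodic.qParam, ← pow_mul, ← Complex.exp_nat_mul]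
    congr 1; push_cast; ring
  have hq4 : Function.Periodic.qParam 4 τ * Function.Periodic.qParam 4 (3 * τ) = r ^ 2 := by
    rw [← h, Function.Periodic.qParam, Function.Periodic.qParam, Function.Periodic.qParam,
      ← Complex.exp_add, ← Complex.exp_nat_mul]
    congr 1; push_cast; ring
  have hr3 : ‖r ^ 3‖ < 1 := by rw [norm_pow]; exact pow_lt_one₀ (norm_nonneg _) hr (by omega)
  have e1 := contFracX_eq hr (by simpa using hq 1)
  have e2 := contFracX_eq hr3 (by simpa using hq 3)
  simp only [qProd_pow] at e2
  have s1 := thetaSeries_self_mul_qProd hr0 hr one_ne_zero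
  have s9 := thetaSeries_self_mul_qProd hr0 hr (k := 9) (by omega)
  have t1 := qProd_split_two (-1) hr (m := 2) (by omega) 2
  have t9 := qProd_split_two (-1) hr (m := 18) (by omega) 18
  norm_num at e2 s1 s9 t1 t9
  rw [t1] at s1
  rw [t9] at s9
  have hne : ∀ m a : ℕ, m ≠ 0 → a ≠ 0 → qProd (-1) r m a ≠ 0 := fun m a =>
    qProd_neg_one_ne_zero hr
  have n1 := hne 4 4 (by omega) (by omega)
  have n2 := hne 12 6 (by omega) (by omega)
  have n3 := hne 12 12 (by omega) (by omega)
  have n4 := hne 36 18 (by omega) (by omega)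
  have n5 := hne 36 36 (by omega) (by omega)
  have n6 := hne 4 2 (by omega) (by omega)
  have S1 : thetaSeries r 1 1 = 2 * qProd (-1) r 4 4 / qProd (-1) r 4 2 := by
    rw [eq_div_iff n6]; apply mul_right_cancel₀ n1; linear_combination s1
  have S9 : thetaSeries r 9 9 = 2 * qProd (-1) r 36 36 / qProd (-1) r 36 18 := by
    rw [eq_div_iff n4]; apply mul_right_cancel₀ n5; linear_combination s9
  rw [← eq_div_iff (mul_ne_zero n1 n2)] at e1
  rw [← eq_div_iff (mul_ne_zero n3 n4)] at e2
  rw [modularW, e1, e2, S1, S9, ← hq4]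
  field_simp

/-! ### The modular equation -/

theorem modularW_equation (τ : UpperHalfPlane) :
    modularW (τ : ℂ) ^ 2 - modularW (2 * (τ : ℂ))
        + 2 * modularW (τ : ℂ) * modularW (2 * (τ : ℂ))
        - 3 * modularW (τ : ℂ) ^ 2 * modularW (2 * (τ : ℂ))
        + modularW (2 * (τ : ℂ)) ^ 2 = 0 := by
  obtain ⟨r, h⟩ : ∃ r, Function.Periodic.qParam 2 (τ : ℂ) = r := ⟨_, rfl⟩
  have hr0 : r ≠ 0 := h ▸ Function.Periodic.qParam_ne_zero _
  have hr : ‖r‖ < 1 := h ▸ Function.Periodic.norm_qParam_lt_one two_pos τ.im_pos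
  have hr2 : ‖r ^ 2‖ < 1 := norm_sq_lt_one hr
  have h2 : Function.Periodic.qParam 2 (2 * (τ : ℂ)) = r ^ 2 := by
    rw [← h, Function.Periodic.qParam, Function.Periodic.qParam, ← Complex.exp_nat_mul]
    congr 1; push_cast; ring
  rw [modularW_eq hr0 hr h, modularW_eq (pow_ne_zero 2 hr0) hr2 h2]
  simp only [thetaSeries_pow]
  have q1 := thetaSeries_self_sq hr0 hr one_ne_zero
  have q9 := thetaSeries_self_sq hr0 hr (k := 9) (by omega)
  have d1 := thetaSeries_self_dissection hr0 hr one_ne_zero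
  have d2 := thetaSeries_self_dissection hr0 hr two_ne_zero
  have d0 := thetaSeries_zero_dissection hr0 hr two_ne_zero
  have m := thetaSeries_mul_eq hr0 hr
  have n1 := thetaSeries_self_ne_zero hr0 hr one_ne_zero
  have n2 := thetaSeries_self_ne_zero hr0 hr two_ne_zero
  norm_num at q1 q9 d1 d2 d0 m n1 n2 ⊢
  generalize thetaSeries r 1 1 = S1 at *
  generalize thetaSeries r 2 2 = S2 at *
  generalize thetaSeries r 9 9 = S9 at *
  generalize thetaSeries r 18 18 = S18 at *
  generalize thetaSeries r 9 3 = A at *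
  generalize thetaSeries r 18 6 = B at *
  generalize thetaSeries r 2 0 = F1 at *
  generalize thetaSeries r 18 0 = F9 at *
  generalize thetaSeries r 18 12 = O at *
  -- Clearing denominators and eliminating `S1²` and `S9²` by `q1` and `q9` leaves `2 r⁴ S2 S18`
  -- times this expression.
  have key : F9 * S2 - F1 * S2 + r ^ 2 * S1 * S9 - 3 * r ^ 4 * F9 * S18 + r ^ 4 * F1 * S18 = 0 := by
    rw [d0, d1, d2]
    linear_combination 2 * r ^ 2 * m + r ^ 4 * q9
  field_simp
  linear_combination (r ^ 4 * 2 * S2 * S18) * key + (r ^ 4 * S2 ^ 2 - 3 * r ^ 8 * S2 * S18) * q9 +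
    (r ^ 8 * S18 ^ 2 - r ^ 4 * S2 * S18) * q1

/-! ### Irreducibility -/

theorem irreducible_modularPolynomial : Irreducible
      ((MvPolynomial.X 0 ^ 2 - MvPolynomial.X 1
        + 2 * MvPolynomial.X 0 * MvPolynomial.X 1
        - 3 * MvPolynomial.X 0 ^ 2 * MvPolynomial.X 1
        + MvPolynomial.X 1 ^ 2 : MvPolynomial (Fin 2) ℂ)) := by
  -- `finSuccEquiv` singles out variable 0, so the swap makes `Y` the polynomial variable, in which
  -- the polynomial is monic.
  let e := (MvPolynomial.renameEquiv ℂ (Equiv.swap (0 : Fin 2) 1)).trans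
    (MvPolynomial.finSuccEquiv ℂ 1)
  rw [← MulEquiv.irreducible_iff e.toMulEquiv]
  let t : MvPolynomial (Fin 1) ℂ := MvPolynomial.X 0
  have he : e.toMulEquiv (MvPolynomial.X 0 ^ 2 - MvPolynomial.X 1
        + 2 * MvPolynomial.X 0 * MvPolynomial.X 1
        - 3 * MvPolynomial.X 0 ^ 2 * MvPolynomial.X 1
        + MvPolynomial.X 1 ^ 2) = Polynomial.C 1 * Polynomial.X ^ 2 +
          Polynomial.C (-1 + 2 * t - 3 * t ^ 2) * Polynomial.X + Polynomial.C (t ^ 2) := by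
    have e0 : e (MvPolynomial.X 0) = Polynomial.C t := by
      simp only [e, AlgEquiv.trans_apply, MvPolynomial.renameEquiv_apply, MvPolynomial.rename_X,
        Equiv.swap_apply_left]
      exact MvPolynomial.finSuccEquiv_X_succ (j := 0)
    have e1 : e (MvPolynomial.X 1) = Polynomial.X := by
      simp only [e, AlgEquiv.trans_apply, MvPolynomial.renameEquiv_apply, MvPolynomial.rename_X,
        Equiv.swap_apply_right]
      exact MvPolynomial.finSuccEquiv_X_zero
    change e _ = _
    simp only [map_add, map_sub, map_mul, map_pow, map_ofNat, map_neg, map_one, e0, e1]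
    ring
  rw [he]
  set b := -1 + 2 * t - 3 * t ^ 2 with hb
  have hd : (Polynomial.C 1 * Polynomial.X ^ 2 + Polynomial.C b * Polynomial.X +
      Polynomial.C (t ^ 2)).natDegree = 2 := Polynomial.natDegree_quadratic one_ne_zero
  have hm : (Polynomial.C 1 * Polynomial.X ^ 2 + Polynomial.C b * Polynomial.X +
      Polynomial.C (t ^ 2)).Monic := Polynomial.leadingCoeff_quadratic one_ne_zero
  by_contra hirr
  obtain ⟨c₁, c₂, h0, h1⟩ := (hm.not_irreducible_iff_exists_add_mul_eq_coeff hd).1 hirr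
  have k0 : t ^ 2 = c₁ * c₂ := by
    simpa [Polynomial.coeff_C, -map_pow] using h0
  have k1 : b = c₁ + c₂ := by
    simpa [Polynomial.coeff_X, Polynomial.coeff_C, Polynomial.coeff_X_pow, -map_pow] using h1
  have disc : (c₁ - c₂) ^ 2 = (1 - t) * ((1 - 3 * t) * (1 + 3 * t ^ 2)) := by
    linear_combination (-(c₁ + c₂) - b) * k1 + 4 * k0 + (b + (-1 + 2 * t - 3 * t ^ 2)) * hb
  -- At `t = 1` the right side vanishes, hence so does `c₁ - c₂`, and the derivative of its square
  -- is 0 there. The derivative of the right side is 8.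
  have hv := congrArg (MvPolynomial.eval fun _ => (1 : ℂ)) disc
  have hv' := congrArg (fun p => MvPolynomial.eval (fun _ => (1 : ℂ)) (MvPolynomial.pderiv 0 p)) disc
  simp only [t, map_pow, map_mul, map_sub, map_one, map_ofNat, MvPolynomial.eval_X, sub_self,
    zero_mul] at hv
  have hv0 := pow_eq_zero_iff two_ne_zero |>.1 hv
  simp [t, Derivation.leibniz, Derivation.leibniz_pow, hv0] at hv'
  norm_num at hv'

theorem theorem3 :
    (∀ τ : UpperHalfPlane,
      modularW (τ : ℂ) ^ 2 - modularW (2 * (τ : ℂ))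
        + 2 * modularW (τ : ℂ) * modularW (2 * (τ : ℂ))
        - 3 * modularW (τ : ℂ) ^ 2 * modularW (2 * (τ : ℂ))
        + modularW (2 * (τ : ℂ)) ^ 2 = 0) ∧
    Irreducible
      ((MvPolynomial.X 0 ^ 2 - MvPolynomial.X 1
        + 2 * MvPolynomial.X 0 * MvPolynomial.X 1
        - 3 * MvPolynomial.X 0 ^ 2 * MvPolynomial.X 1
        + MvPolynomial.X 1 ^ 2 : MvPolynomial (Fin 2) ℂ)) :=
  ⟨modularW_equation, irreducible_modularPolynomial⟩
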